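/- Let $\mathbb F$ be a division ring with center $Z_{\mathbb F}$, and let $\mathbb F[z]$ be the ring of polynomials in a variable $z$ that commutes with the coefficients. For $f=\sum_j z^jf_j\in\mathbb F[z]$ and $\alpha\in\mathbb F$ put $f^{\mathfrak e_\ell}(\alpha)=\sum_j\alpha^jf_j$ and $f^{\mathfrak e_r}(\alpha)=\sum_j f_j\alpha^j$. For a finite set $\Delta\subset\mathbb F$ let $P_{\Delta,\ell}$ (respectively $P_{\Delta,r}$) be the monic generator of the intersection of the right ideals $(z-\alpha)\mathbb F[z]$ (respectively of the left ideals $\mathbb F[z](z-\alpha)$), $\alpha\in\Delta$; for $\Delta=\varnothing$ both are $1$. The set $\Delta$ is called left (right) $P$-independent if $\deg P_{\Delta,\ell}=|\Delta|$ (respectively $\deg P_{\Delta,r}=|\Delta|$). Write $\alpha\sim\beta$ if $\beta=h\alpha h^{-1}$ for some $h\in\mathbb F\setminus\{0\}$. Let $\Lambda=\{\alpha_1,\dots,\alpha_n\}$ be a set of $n$ distinct elements of $\mathbb F$, each algebraic over $Z_{\mathbb F}$, and let $\Omega=\{\beta_1,\dots,\beta_k\}$ be a set of $k$ distinct elements of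 $\mathbb F$. Assume that $\Lambda$ is left $P$-independent and that $\Omega$ is right $P$-independent. Put $p_i=P_{\Lambda\setminus\{\alpha_i\},\ell}$ and $q_j=P_{\Omega\setminus\{\beta_j\},r}$. Then $p_i^{\mathfrak e_\ell}(\alpha_i)\ne0$ for all $i$, $q_j^{\mathfrak e_r}(\beta_j)\neq 0$ for all $j$, and the polynomials $g\in\mathbb F[z]$ with $$\deg g<n+k,\qquad g^{\mathfrak e_\ell}(\alpha_i)=0\ \ (i=1,\dots,n),\qquad g^{\mathfrak e_r}(\beta_j)=0\ \ (j=1,\dots,k)$$ are exactly the polynomials of the form $$g(z)=P_{\Lambda,\ell}(z)\cdot\sum_{(i,j):\,\alpha_i\sim\beta_j}p_i^{\mathfrak e_\ell}(\alpha_i)^{-1}\,\varphi_{ij}\,q_j^{\mathfrak e_r}(\beta_j)^{-1}\,q_j(z),$$ where each $\varphi_{ij}\in\mathbb F$ is an arbitrary intertwiner of $\alpha_i$ and $\beta_j$, that is, $\alpha_i\varphi_{ij}=\varphi_{ij}\beta_j$. (The zero polynomial has degree $-\infty$.) -/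

import Mathlib

open Polynomial

namespace TwoSidedLagrange

/-- Left evaluation `f ↦ ∑ⱼ aʲ fⱼ` of a polynomial `f = ∑ⱼ zʲ fⱼ` whose variable commutes with the
coefficients. The right evaluation `∑ⱼ fⱼ aʲ` is `Polynomial.eval a f`. -/
def leftEval {F : Type*} [Ring F] (f : F[X]) (a : F) : F :=
  f.sum fun j c => a ^ j * c

/-- The right ideal `p · F[z]` generated by `p`. (The left ideal `F[z] · p` is `Ideal.span {p}`.) -/
noncomputable def rightIdeal {F : Type*} [Ring F] (p : F[X]) : Submodule (F[X])ᵐᵒᵖ F[X] :=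
  Submodule.span (F[X])ᵐᵒᵖ {p}

/-- `P` is the least right common multiple of the polynomials `z - a`, `a ∈ Δ`: the monic generator
of the intersection of the right ideals `(z - a) · F[z]`. -/
def IsLeftMinPoly {F : Type*} [Ring F] (Δ : Set F) (P : F[X]) : Prop :=
  P.Monic ∧ rightIdeal P = ⨅ a ∈ Δ, rightIdeal (X - C a)

/-- `P` is the least left common multiple of the polynomials `z - a`, `a ∈ Δ`: the monic generator
of the intersection of the left ideals `F[z] · (z - a)`. -/
def IsRightMinPoly {F : Type*} [Ring F] (Δ : Set F) (P : F[X]) : Prop :=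
  P.Monic ∧ Ideal.span {P} = ⨅ a ∈ Δ, Ideal.span {X - C a}

open scoped Classical in
/-- The left minimal polynomial `P_{Δ,ℓ}` of `Δ` (it is `0` when no monic generator exists, which
does not happen for finite `Δ` in a division ring). -/
noncomputable def leftMinPoly {F : Type*} [Ring F] (Δ : Set F) : F[X] :=
  if h : ∃ P, IsLeftMinPoly Δ P then h.choose else 0

open scoped Classical in
/-- The right minimal polynomial `P_{Δ,r}` of `Δ` (it is `0` when no monic generator exists, which
does not happen for finite `Δ` in a division ring). -/
noncomputable def rightMinPoly {F : Type*} [Ring F] (Δ : Set F) : F[X] :=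
  if h : ∃ P, IsRightMinPoly Δ P then h.choose else 0

/-- `Δ` is left polynomially independent: `deg P_{Δ,ℓ} = |Δ|`. -/
def LeftPIndependent {F : Type*} [Ring F] (Δ : Set F) : Prop :=
  ((leftMinPoly Δ).natDegree : ℕ∞) = Δ.encard

/-- `Δ` is right polynomially independent: `deg P_{Δ,r} = |Δ|`. -/
def RightPIndependent {F : Type*} [Ring F] (Δ : Set F) : Prop :=
  ((rightMinPoly Δ).natDegree : ℕ∞) = Δ.encard

section WellDefined

variable {F : Type*} [DivisionRing F]

theorem mem_rightIdeal {p f : F[X]} : f ∈ rightIdeal p ↔ ∃ h, p * h = f := by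
  rw [rightIdeal, Submodule.mem_span_singleton]
  exact ⟨fun ⟨a, ha⟩ => ⟨a.unop, ha⟩, fun ⟨h, hh⟩ => ⟨MulOpposite.op h, hh⟩⟩

theorem exists_left_div (f : F[X]) (a : F) : ∃ c h, f = C c + (X - C a) * h := by
  induction f using Polynomial.induction_on' with
  | add p q hp hq =>
    obtain ⟨c, h, rfl⟩ := hp
    obtain ⟨d, k, rfl⟩ := hq
    exact ⟨c + d, h + k, by rw [C_add, mul_add]; abel⟩
  | monomial n b =>
    have hc : Commute (X : F[X]) (C a) := commute_X (C a)
    refine ⟨a ^ n * b, (∑ i ∈ Finset.range n, X ^ i * C a ^ (n - 1 - i)) * C b, ?_⟩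
    rw [← mul_assoc, hc.mul_geom_sum₂, sub_mul, C_mul, C_pow, X_pow_mul_C, C_mul_X_pow_eq_monomial]
    abel

theorem exists_right_div (f : F[X]) (a : F) : ∃ c h, f = C c + h * (X - C a) := by
  induction f using Polynomial.induction_on' with
  | add p q hp hq =>
    obtain ⟨c, h, rfl⟩ := hp
    obtain ⟨d, k, rfl⟩ := hq
    exact ⟨c + d, h + k, by rw [C_add, add_mul]; abel⟩
  | monomial n b =>
    have hc : Commute (X : F[X]) (C a) := commute_X (C a)
    refine ⟨b * a ^ n, C b * (∑ i ∈ Finset.range n, X ^ i * C a ^ (n - 1 - i)), ?_⟩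
    rw [mul_assoc, hc.geom_sum₂_mul, mul_sub, C_mul, C_pow, C_mul_X_pow_eq_monomial]
    abel

theorem exists_isLeftMinPoly {Δ : Set F} (hΔ : Δ.Finite) : ∃ P, IsLeftMinPoly Δ P := by
  induction Δ, hΔ using Set.Finite.induction_on with
  | empty =>
    refine ⟨1, monic_one, ?_⟩
    simp only [Set.mem_empty_iff_false, iInf_false, iInf_top, eq_top_iff]
    exact fun f _ => mem_rightIdeal.2 ⟨f, one_mul f⟩
  | @insert a Δ _ _ ih =>
    obtain ⟨P, hP, hI⟩ := ih
    obtain ⟨c, L, hL⟩ := exists_left_div P a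
    simp only [IsLeftMinPoly, iInf_insert, ← hI]
    by_cases hc : c = 0
    · refine ⟨P, hP, (inf_eq_right.2 ?_).symm⟩
      intro f hf
      obtain ⟨h, rfl⟩ := mem_rightIdeal.1 hf
      refine mem_rightIdeal.2 ⟨L * h, ?_⟩
      rw [hL, hc, C_0, zero_add, mul_assoc]
    · have key : C c * (X - C (c⁻¹ * a * c)) = (X - C a) * C c := by
        rw [mul_sub, sub_mul, ← C_mul, ← C_mul, X_mul_C]
        congr 2
        rw [mul_assoc, mul_inv_cancel_left₀ hc]
      have hcc : C c * C c⁻¹ = (1 : F[X]) := by rw [← C_mul, mul_inv_cancel₀ hc, C_1]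
      have hcc' : C c⁻¹ * C c = (1 : F[X]) := by rw [← C_mul, inv_mul_cancel₀ hc, C_1]
      refine ⟨P * (X - C (c⁻¹ * a * c)), hP.mul (monic_X_sub_C _), le_antisymm ?_ ?_⟩
      · intro f hf
        obtain ⟨h, rfl⟩ := mem_rightIdeal.1 hf
        refine ⟨mem_rightIdeal.2 ⟨(C c + L * (X - C (c⁻¹ * a * c))) * h, ?_⟩,
          mem_rightIdeal.2 ⟨(X - C (c⁻¹ * a * c)) * h, (mul_assoc _ _ _).symm⟩⟩
        rw [← mul_assoc, mul_add, ← key, hL, add_mul (C c), mul_assoc (X - C a) L]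
      · rintro f ⟨hf₁, hf₂⟩
        obtain ⟨h, rfl⟩ := mem_rightIdeal.1 hf₂
        obtain ⟨u, hu⟩ := mem_rightIdeal.1 hf₁
        have h1 : C c * h = (X - C a) * (u - L * h) := by
          rw [mul_sub, hu, hL, add_mul, mul_assoc]; abel
        have h2 : (X - C (c⁻¹ * a * c)) * (C c⁻¹ * (u - L * h)) = h := by
          have : C c * ((X - C (c⁻¹ * a * c)) * (C c⁻¹ * (u - L * h))) = C c * h := by
            rw [← mul_assoc, key, mul_assoc, ← mul_assoc (C c), hcc, one_mul, h1]
          calc _ = C c⁻¹ * (C c * ((X - C (c⁻¹ * a * c)) * (C c⁻¹ * (u - L * h)))) := by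
                rw [← mul_assoc (C c⁻¹) (C c), hcc', one_mul]
            _ = h := by rw [this, ← mul_assoc, hcc', one_mul]
        exact mem_rightIdeal.2 ⟨C c⁻¹ * (u - L * h), by rw [mul_assoc, h2]⟩

theorem exists_isRightMinPoly {Δ : Set F} (hΔ : Δ.Finite) : ∃ P, IsRightMinPoly Δ P := by
  induction Δ, hΔ using Set.Finite.induction_on with
  | empty =>
    refine ⟨1, monic_one, ?_⟩
    simp only [Set.mem_empty_iff_false, iInf_false, iInf_top, Ideal.span_singleton_one]
  | @insert a Δ _ _ ih =>
    obtain ⟨P, hP, hI⟩ := ih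
    obtain ⟨c, L, hL⟩ := exists_right_div P a
    simp only [IsRightMinPoly, iInf_insert, ← hI]
    by_cases hc : c = 0
    · refine ⟨P, hP, (inf_eq_right.2 ?_).symm⟩
      intro f hf
      obtain ⟨h, rfl⟩ := Ideal.mem_span_singleton'.1 hf
      refine Ideal.mem_span_singleton'.2 ⟨h * L, ?_⟩
      rw [hL, hc, C_0, zero_add, mul_assoc]
    · have key : (X - C (c * a * c⁻¹)) * C c = C c * (X - C a) := by
        rw [mul_sub, sub_mul, ← C_mul, ← C_mul, X_mul_C]
        congr 2
        rw [mul_assoc, inv_mul_cancel₀ hc, mul_one]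
      have hcc : C c * C c⁻¹ = (1 : F[X]) := by rw [← C_mul, mul_inv_cancel₀ hc, C_1]
      have hcc' : C c⁻¹ * C c = (1 : F[X]) := by rw [← C_mul, inv_mul_cancel₀ hc, C_1]
      refine ⟨(X - C (c * a * c⁻¹)) * P, (monic_X_sub_C _).mul hP, le_antisymm ?_ ?_⟩
      · intro f hf
        obtain ⟨h, rfl⟩ := Ideal.mem_span_singleton'.1 hf
        refine ⟨Ideal.mem_span_singleton'.2 ⟨h * (C c + (X - C (c * a * c⁻¹)) * L), ?_⟩,
          Ideal.mem_span_singleton'.2 ⟨h * (X - C (c * a * c⁻¹)), by rw [mul_assoc]⟩⟩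
        rw [mul_assoc, add_mul, ← key, hL, mul_add (X - C (c * a * c⁻¹)), mul_assoc (X - C (c * a * c⁻¹)) L]
      · rintro f ⟨hf₁, hf₂⟩
        obtain ⟨h, rfl⟩ := Ideal.mem_span_singleton'.1 hf₂
        obtain ⟨u, hu⟩ := Ideal.mem_span_singleton'.1 hf₁
        have h1 : h * C c = (u - h * L) * (X - C a) := by
          rw [sub_mul, hu, hL, mul_add, mul_assoc]; abel
        have h2 : (u - h * L) * C c⁻¹ * (X - C (c * a * c⁻¹)) = h := by
          have : (u - h * L) * C c⁻¹ * (X - C (c * a * c⁻¹)) * C c = h * C c := by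
            rw [mul_assoc, key, ← mul_assoc, mul_assoc _ (C c⁻¹), hcc', mul_one, h1]
          calc _ = (u - h * L) * C c⁻¹ * (X - C (c * a * c⁻¹)) * C c * C c⁻¹ := by
                rw [mul_assoc _ (C c), hcc, mul_one]
            _ = h := by rw [this, mul_assoc, hcc, mul_one]
        exact Ideal.mem_span_singleton'.2 ⟨(u - h * L) * C c⁻¹, by rw [← mul_assoc, h2]⟩

theorem IsLeftMinPoly.unique {Δ : Set F} {P Q : F[X]} (hP : IsLeftMinPoly Δ P)
    (hQ : IsLeftMinPoly Δ Q) : P = Q := by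
  have e : rightIdeal P = rightIdeal Q := hP.2.trans hQ.2.symm
  obtain ⟨h, hh⟩ := mem_rightIdeal.1 (e ▸ mem_rightIdeal.2 ⟨1, mul_one P⟩ : P ∈ rightIdeal Q)
  obtain ⟨k, hk⟩ := mem_rightIdeal.1 (e ▸ mem_rightIdeal.2 ⟨1, mul_one Q⟩ : Q ∈ rightIdeal P)
  have hm : h.Monic := Monic.of_mul_monic_left hQ.1 (hh ▸ hP.1)
  have km : k.Monic := Monic.of_mul_monic_left hP.1 (hk ▸ hQ.1)
  have d1 := hQ.1.natDegree_mul hm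
  have d2 := hP.1.natDegree_mul km
  rw [hh] at d1
  rw [hk] at d2
  rw [← hh, hm.natDegree_eq_zero.1 (by omega), mul_one]

theorem IsRightMinPoly.unique {Δ : Set F} {P Q : F[X]} (hP : IsRightMinPoly Δ P)
    (hQ : IsRightMinPoly Δ Q) : P = Q := by
  have e : Ideal.span {P} = Ideal.span {Q} := hP.2.trans hQ.2.symm
  obtain ⟨h, hh⟩ := Ideal.mem_span_singleton'.1 (e ▸ Ideal.mem_span_singleton_self P)
  obtain ⟨k, hk⟩ := Ideal.mem_span_singleton'.1 (e ▸ Ideal.mem_span_singleton_self Q)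
  have hm : h.Monic := Monic.of_mul_monic_right hQ.1 (hh ▸ hP.1)
  have km : k.Monic := Monic.of_mul_monic_right hP.1 (hk ▸ hQ.1)
  have d1 := hm.natDegree_mul hQ.1
  have d2 := km.natDegree_mul hP.1
  rw [hh] at d1
  rw [hk] at d2
  rw [← hh, hm.natDegree_eq_zero.1 (by omega), one_mul]

/-- For finite `Δ` the polynomial `leftMinPoly Δ` is the least right common multiple. -/
theorem isLeftMinPoly_leftMinPoly {Δ : Set F} (hΔ : Δ.Finite) :
    IsLeftMinPoly Δ (leftMinPoly Δ) := by
  have h := exists_isLeftMinPoly hΔ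
  rw [leftMinPoly, dif_pos h]
  exact h.choose_spec

/-- For finite `Δ` the polynomial `rightMinPoly Δ` is the least left common multiple. -/
theorem isRightMinPoly_rightMinPoly {Δ : Set F} (hΔ : Δ.Finite) :
    IsRightMinPoly Δ (rightMinPoly Δ) := by
  have h := exists_isRightMinPoly hΔ
  rw [rightMinPoly, dif_pos h]
  exact h.choose_spec

end WellDefined

end TwoSidedLagrange

/-! Write `P` for the left minimal polynomial of the `α i`. The left conditions say `g = P * h`, and
the degree bound becomes `deg h < k`, so right Lagrange interpolation (`eq_sum_C_mul_rightMinPoly`)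
recovers `h` from its right values `d` at the `β j`. Dividing `h` by `X - C b` on the right shows
that `P * h` has right zero `b` exactly when `P * C d` does.

It remains to find these `d`. If `P * C d = u * (X - C b)`, left evaluation at `α i` makes the left
value of `u` there an intertwiner of `α i` and `b`. Expanding `u` by left Lagrange interpolation
(`eq_sum_leftMinPoly_mul_C`) and comparing leading coefficients expresses `d` through these
intertwiners. Conversely, `P` is `p_i` times a linear factor whose root is conjugate to `α i`, so
each intertwiner gives a valid `d`. Nonzero intertwiners exist only between conjugate elements,
whence the restricted sum. -/

namespace TwoSidedLagrange

/-! ### Left evaluation. -/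

section LeftEvaluation

variable {F : Type*} [Ring F]

theorem leftEval_zero (a : F) : leftEval (0 : F[X]) a = 0 := by simp [leftEval]

theorem leftEval_add (f g : F[X]) (a : F) :
    leftEval (f + g) a = leftEval f a + leftEval g a :=
  sum_add_index f g _ (fun _ => mul_zero _) fun _ _ _ => mul_add _ _ _

theorem leftEval_monomial (m : ℕ) (c a : F) : leftEval (monomial m c) a = a ^ m * c :=
  sum_monomial_index c _ (mul_zero _)

theorem leftEval_C (c a : F) : leftEval (C c) a = c := by
  rw [← monomial_zero_left, leftEval_monomial, pow_zero, one_mul]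

/-- Left evaluation at `a` as an additive homomorphism. -/
def leftEvalHom (a : F) : F[X] →+ F where
  toFun f := leftEval f a
  map_zero' := leftEval_zero a
  map_add' f g := leftEval_add f g a

theorem leftEval_sub (f g : F[X]) (a : F) :
    leftEval (f - g) a = leftEval f a - leftEval g a :=
  map_sub (leftEvalHom a) f g

theorem leftEval_sum {ι : Type*} (s : Finset ι) (f : ι → F[X]) (a : F) :
    leftEval (∑ i ∈ s, f i) a = ∑ i ∈ s, leftEval (f i) a :=
  map_sum (leftEvalHom a) f s

theorem leftEval_mul_C (f : F[X]) (c a : F) : leftEval (f * C c) a = leftEval f a * c := by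
  induction f using Polynomial.induction_on' with
  | add p q hp hq => rw [add_mul, leftEval_add, hp, hq, leftEval_add, add_mul]
  | monomial m b => rw [monomial_mul_C, leftEval_monomial, leftEval_monomial, mul_assoc]

theorem leftEval_mul_X (f : F[X]) (a : F) : leftEval (f * X) a = a * leftEval f a := by
  induction f using Polynomial.induction_on' with
  | add p q hp hq => rw [add_mul, leftEval_add, hp, hq, leftEval_add, mul_add]
  | monomial m b =>
    rw [monomial_mul_X, leftEval_monomial, leftEval_monomial, pow_succ', mul_assoc]

/-- The constant must be the evaluation point itself: it commutes with its own powers, which an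
arbitrary constant need not do. -/
theorem leftEval_C_mul (f : F[X]) (a : F) : leftEval (C a * f) a = a * leftEval f a := by
  induction f using Polynomial.induction_on' with
  | add p q hp hq => rw [mul_add, leftEval_add, hp, hq, leftEval_add, mul_add]
  | monomial m b =>
    rw [C_mul_monomial, leftEval_monomial, leftEval_monomial, ← mul_assoc, ← pow_succ,
      ← mul_assoc, ← pow_succ']

theorem leftEval_X_sub_C_mul (f : F[X]) (a : F) : leftEval ((X - C a) * f) a = 0 := by
  rw [sub_mul, leftEval_sub, X_mul, leftEval_mul_X, leftEval_C_mul, sub_self]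

end LeftEvaluation

/-! ### Minimal polynomials and one-sided zeros. -/

section MinimalPolynomials

variable {F : Type*} [DivisionRing F]

theorem exists_eq_C_leftEval_add (f : F[X]) (a : F) :
    ∃ h, f = C (leftEval f a) + (X - C a) * h := by
  obtain ⟨c, h, e⟩ := exists_left_div f a
  have hc : leftEval f a = c := by
    rw [e, leftEval_add, leftEval_C, leftEval_X_sub_C_mul, add_zero]
  exact ⟨h, by rw [hc, ← e]⟩

theorem exists_eq_C_eval_add (f : F[X]) (b : F) :
    ∃ h, f = C (f.eval b) + h * (X - C b) := by
  obtain ⟨c, h, e⟩ := exists_right_div f b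
  have hc : f.eval b = c := by
    rw [e, eval_add, eval_C, eval_mul_X_sub_C, add_zero]
  exact ⟨h, by rw [hc, ← e]⟩

theorem mem_rightIdeal_X_sub_C {f : F[X]} {a : F} :
    f ∈ rightIdeal (X - C a) ↔ leftEval f a = 0 := by
  rw [mem_rightIdeal]
  constructor
  · rintro ⟨h, rfl⟩
    exact leftEval_X_sub_C_mul h a
  · intro hf
    obtain ⟨h, e⟩ := exists_eq_C_leftEval_add f a
    exact ⟨h, by rw [hf, C_0, zero_add] at e; exact e.symm⟩

theorem mem_span_X_sub_C {f : F[X]} {b : F} :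
    f ∈ Ideal.span {X - C b} ↔ f.eval b = 0 := by
  rw [Ideal.mem_span_singleton']
  constructor
  · rintro ⟨h, rfl⟩
    exact eval_mul_X_sub_C b
  · intro hf
    obtain ⟨h, e⟩ := exists_eq_C_eval_add f b
    exact ⟨h, by rw [hf, C_0, zero_add] at e; exact e.symm⟩

theorem leftMinPoly_monic {Δ : Set F} (hΔ : Δ.Finite) : (leftMinPoly Δ).Monic :=
  (isLeftMinPoly_leftMinPoly hΔ).1

theorem rightMinPoly_monic {Δ : Set F} (hΔ : Δ.Finite) : (rightMinPoly Δ).Monic :=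
  (isRightMinPoly_rightMinPoly hΔ).1

/-- The right multiples of `leftMinPoly Δ` are the polynomials with left zeros on `Δ`. -/
theorem exists_leftMinPoly_mul_eq_iff {Δ : Set F} (hΔ : Δ.Finite) {f : F[X]} :
    (∃ h, leftMinPoly Δ * h = f) ↔ ∀ a ∈ Δ, leftEval f a = 0 := by
  rw [← mem_rightIdeal, (isLeftMinPoly_leftMinPoly hΔ).2]
  simp only [Submodule.mem_iInf, mem_rightIdeal_X_sub_C]

/-- The left multiples of `rightMinPoly Δ` are the polynomials with right zeros on `Δ`. -/
theorem exists_mul_rightMinPoly_eq_iff {Δ : Set F} (hΔ : Δ.Finite) {f : F[X]} :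
    (∃ h, h * rightMinPoly Δ = f) ↔ ∀ b ∈ Δ, f.eval b = 0 := by
  rw [← Ideal.mem_span_singleton', (isRightMinPoly_rightMinPoly hΔ).2]
  simp only [Submodule.mem_iInf, mem_span_X_sub_C]

theorem leftEval_leftMinPoly {Δ : Set F} (hΔ : Δ.Finite) {a : F} (ha : a ∈ Δ) :
    leftEval (leftMinPoly Δ) a = 0 :=
  (exists_leftMinPoly_mul_eq_iff hΔ).1 ⟨1, mul_one _⟩ a ha

theorem eval_rightMinPoly {Δ : Set F} (hΔ : Δ.Finite) {b : F} (hb : b ∈ Δ) :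
    (rightMinPoly Δ).eval b = 0 :=
  (exists_mul_rightMinPoly_eq_iff hΔ).1 ⟨1, one_mul _⟩ b hb

/-- A nonzero right multiple of the minimal polynomial has at least its degree. This is the
uniqueness half of interpolation. -/
theorem eq_zero_of_leftEval_eq_zero {Δ : Set F} (hΔ : Δ.Finite) {f : F[X]}
    (hd : f.degree < (leftMinPoly Δ).degree) (hf : ∀ a ∈ Δ, leftEval f a = 0) : f = 0 := by
  obtain ⟨h, rfl⟩ := (exists_leftMinPoly_mul_eq_iff hΔ).2 hf
  by_contra h0
  have hh : h ≠ 0 := by rintro rfl; exact h0 (mul_zero _)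
  rw [degree_mul] at hd
  exact hd.not_ge (le_add_of_nonneg_right (zero_le_degree_iff.2 hh))

theorem eq_zero_of_eval_eq_zero {Δ : Set F} (hΔ : Δ.Finite) {f : F[X]}
    (hd : f.degree < (rightMinPoly Δ).degree) (hf : ∀ b ∈ Δ, f.eval b = 0) : f = 0 := by
  obtain ⟨h, rfl⟩ := (exists_mul_rightMinPoly_eq_iff hΔ).2 hf
  by_contra h0
  have hh : h ≠ 0 := by rintro rfl; exact h0 (zero_mul _)
  rw [degree_mul] at hd
  exact hd.not_ge (le_add_of_nonneg_left (zero_le_degree_iff.2 hh))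

/-- Multiplying by a suitable linear factor on the right adds a left zero. -/
theorem leftEval_mul_X_sub_C_conj {f : F[X]} {a : F} (hf : leftEval f a ≠ 0) :
    leftEval (f * (X - C ((leftEval f a)⁻¹ * a * leftEval f a))) a = 0 := by
  rw [mul_sub, leftEval_sub, leftEval_mul_X, leftEval_mul_C, mul_assoc, mul_inv_cancel_left₀ hf,
    sub_self]

/-- Multiplying on the right keeps left zeros. -/
theorem leftEval_mul_eq_zero {f : F[X]} {a : F} (hf : leftEval f a = 0) (g : F[X]) :
    leftEval (f * g) a = 0 := by
  obtain ⟨h, rfl⟩ := mem_rightIdeal.1 (mem_rightIdeal_X_sub_C.2 hf)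
  rw [mul_assoc, leftEval_X_sub_C_mul]

/-- Multiplying on the left keeps right zeros. -/
theorem eval_mul_eq_zero {f : F[X]} {b : F} (hf : f.eval b = 0) (g : F[X]) :
    (g * f).eval b = 0 := by
  obtain ⟨h, rfl⟩ := Ideal.mem_span_singleton'.1 (mem_span_X_sub_C.2 hf)
  rw [← mul_assoc, eval_mul_X_sub_C]

/-- Multiplying by a suitable linear factor on the left adds a right zero. -/
theorem eval_X_sub_C_conj_mul {f : F[X]} {b : F} (hf : f.eval b ≠ 0) :
    ((X - C (f.eval b * b * (f.eval b)⁻¹)) * f).eval b = 0 := by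
  rw [sub_mul, eval_sub, X_mul, eval_mul_X, eval_C_mul, inv_mul_cancel_right₀ hf, sub_self]

/-- A monic polynomial vanishing on `Δ` is built point by point, at the cost of at most one linear
factor each. -/
theorem natDegree_leftMinPoly_le {Δ : Set F} (hΔ : Δ.Finite) :
    (leftMinPoly Δ).natDegree ≤ Δ.ncard := by
  suffices H : ∃ R : F[X], R.Monic ∧ R.natDegree ≤ Δ.ncard ∧ ∀ a ∈ Δ, leftEval R a = 0 by
    obtain ⟨R, hR, hd, h0⟩ := H
    by_contra! hlt
    refine hR.ne_zero (eq_zero_of_leftEval_eq_zero hΔ ?_ h0)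
    exact degree_lt_degree (hd.trans_lt hlt)
  induction Δ, hΔ using Set.Finite.induction_on with
  | empty => exact ⟨1, monic_one, by simp, by simp⟩
  | @insert a Δ ha hΔ ih =>
    obtain ⟨R, hR, hd, h0⟩ := ih
    rw [Set.ncard_insert_of_notMem ha hΔ]
    by_cases hc : leftEval R a = 0
    · exact ⟨R, hR, by omega, by simpa [hc] using h0⟩
    · refine ⟨R * (X - C ((leftEval R a)⁻¹ * a * leftEval R a)), hR.mul (monic_X_sub_C _), ?_, ?_⟩
      · rw [hR.natDegree_mul (monic_X_sub_C _), natDegree_X_sub_C]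
        omega
      · rintro x (rfl | hx)
        · exact leftEval_mul_X_sub_C_conj hc
        · exact leftEval_mul_eq_zero (h0 x hx) _

theorem natDegree_rightMinPoly_le {Δ : Set F} (hΔ : Δ.Finite) :
    (rightMinPoly Δ).natDegree ≤ Δ.ncard := by
  suffices H : ∃ R : F[X], R.Monic ∧ R.natDegree ≤ Δ.ncard ∧ ∀ b ∈ Δ, R.eval b = 0 by
    obtain ⟨R, hR, hd, h0⟩ := H
    by_contra! hlt
    refine hR.ne_zero (eq_zero_of_eval_eq_zero hΔ ?_ h0)
    exact degree_lt_degree (hd.trans_lt hlt)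
  induction Δ, hΔ using Set.Finite.induction_on with
  | empty => exact ⟨1, monic_one, by simp, by simp⟩
  | @insert b Δ hb hΔ ih =>
    obtain ⟨R, hR, hd, h0⟩ := ih
    rw [Set.ncard_insert_of_notMem hb hΔ]
    by_cases hc : R.eval b = 0
    · exact ⟨R, hR, by omega, by simpa [hc] using h0⟩
    · refine ⟨(X - C (R.eval b * b * (R.eval b)⁻¹)) * R, (monic_X_sub_C _).mul hR, ?_, ?_⟩
      · rw [(monic_X_sub_C _).natDegree_mul hR, natDegree_X_sub_C]
        omega
      · rintro x (rfl | hx)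
        · exact eval_X_sub_C_conj_mul hc
        · exact eval_mul_eq_zero (h0 x hx) _

end MinimalPolynomials

/-! ### Auxiliary degree and cardinality bounds. -/

section Degree

theorem degree_mul_C_le {F : Type*} [Ring F] (f : F[X]) (c : F) : (f * C c).degree ≤ f.degree :=
  (degree_mul_le _ _).trans ((add_le_add_right degree_C_le _).trans (add_zero _).le)

theorem degree_C_mul_le {F : Type*} [Ring F] (f : F[X]) (c : F) : (C c * f).degree ≤ f.degree :=
  (degree_mul_le _ _).trans ((add_le_add_left degree_C_le _).trans (zero_add _).le)

theorem ncard_range_diff_singleton_lt {F : Type*} {n : ℕ} (α : Fin n → F) (i : Fin n) :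
    (Set.range α \ {α i}).ncard < n :=
  (Set.ncard_sdiff_singleton_lt_of_mem (Set.mem_range_self i) (Set.finite_range α)).trans_le
    ((Set.ncard_image_le (s := Set.univ) (f := α)).trans (by simp) |>.trans' (by simp))

end Degree

/-! ### One-sided Lagrange interpolation and intertwiners. -/

section Lagrange

variable {F : Type*} [DivisionRing F] {n : ℕ}

theorem degree_leftMinPoly_range {α : Fin n → F} (hα : Function.Injective α)
    (hΛ : LeftPIndependent (Set.range α)) : (leftMinPoly (Set.range α)).degree = n := by
  rw [LeftPIndependent, ← Set.image_univ, hα.encard_image, Set.encard_univ, ENat.card_eq_coe_fintype_card, Fintype.card_fin] at hΛ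
  rw [degree_eq_natDegree (leftMinPoly_monic (Set.finite_range α)).ne_zero]
  rw [Set.image_univ] at hΛ
  exact_mod_cast hΛ

theorem degree_rightMinPoly_range {β : Fin n → F} (hβ : Function.Injective β)
    (hΩ : RightPIndependent (Set.range β)) : (rightMinPoly (Set.range β)).degree = n := by
  rw [RightPIndependent, ← Set.image_univ, hβ.encard_image, Set.encard_univ, ENat.card_eq_coe_fintype_card, Fintype.card_fin] at hΩ
  rw [degree_eq_natDegree (rightMinPoly_monic (Set.finite_range β)).ne_zero]
  rw [Set.image_univ] at hΩ
  exact_mod_cast hΩ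

theorem degree_leftMinPoly_diff_lt (α : Fin n → F) (i : Fin n) :
    (leftMinPoly (Set.range α \ {α i})).degree < n :=
  (natDegree_lt_iff_degree_lt (leftMinPoly_monic (Set.finite_range α).sdiff).ne_zero).1
    ((natDegree_leftMinPoly_le (Set.finite_range α).sdiff).trans_lt
      (ncard_range_diff_singleton_lt α i))

theorem degree_rightMinPoly_diff_lt (β : Fin n → F) (j : Fin n) :
    (rightMinPoly (Set.range β \ {β j})).degree < n :=
  (natDegree_lt_iff_degree_lt (rightMinPoly_monic (Set.finite_range β).sdiff).ne_zero).1
    ((natDegree_rightMinPoly_le (Set.finite_range β).sdiff).trans_lt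
      (ncard_range_diff_singleton_lt β j))

theorem leftEval_leftMinPoly_diff_of_ne {α : Fin n → F} (hα : Function.Injective α) {i m : Fin n}
    (h : m ≠ i) : leftEval (leftMinPoly (Set.range α \ {α i})) (α m) = 0 :=
  leftEval_leftMinPoly (Set.finite_range α).sdiff ⟨Set.mem_range_self m, fun e => h (hα e)⟩

theorem eval_rightMinPoly_diff_of_ne {β : Fin n → F} (hβ : Function.Injective β) {j m : Fin n}
    (h : m ≠ j) : (rightMinPoly (Set.range β \ {β j})).eval (β m) = 0 :=
  eval_rightMinPoly (Set.finite_range β).sdiff ⟨Set.mem_range_self m, fun e => h (hβ e)⟩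

/-- Otherwise a monic polynomial of degree below `n` would have left zeros at all the `α i`, against
independence. -/
theorem leftEval_leftMinPoly_diff_ne_zero {α : Fin n → F} (hα : Function.Injective α)
    (hΛ : LeftPIndependent (Set.range α)) (i : Fin n) :
    leftEval (leftMinPoly (Set.range α \ {α i})) (α i) ≠ 0 := by
  intro h0
  refine (leftMinPoly_monic (Set.finite_range α).sdiff).ne_zero
    (eq_zero_of_leftEval_eq_zero (Set.finite_range α) (f := leftMinPoly (Set.range α \ {α i}))
      ?_ ?_)
  · rw [degree_leftMinPoly_range hα hΛ]
    exact degree_leftMinPoly_diff_lt α i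
  · rintro _ ⟨m, rfl⟩
    rcases eq_or_ne m i with rfl | hm
    exacts [h0, leftEval_leftMinPoly_diff_of_ne hα hm]

theorem eval_rightMinPoly_diff_ne_zero {β : Fin n → F} (hβ : Function.Injective β)
    (hΩ : RightPIndependent (Set.range β)) (j : Fin n) :
    (rightMinPoly (Set.range β \ {β j})).eval (β j) ≠ 0 := by
  intro h0
  refine (rightMinPoly_monic (Set.finite_range β).sdiff).ne_zero
    (eq_zero_of_eval_eq_zero (Set.finite_range β) (f := rightMinPoly (Set.range β \ {β j}))
      ?_ ?_)
  · rw [degree_rightMinPoly_range hβ hΩ]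
    exact degree_rightMinPoly_diff_lt β j
  · rintro _ ⟨m, rfl⟩
    rcases eq_or_ne m j with rfl | hm
    exacts [h0, eval_rightMinPoly_diff_of_ne hβ hm]

/-- Left Lagrange interpolation. -/
theorem eq_sum_leftMinPoly_mul_C {α : Fin n → F} (hα : Function.Injective α)
    (hΛ : LeftPIndependent (Set.range α)) {f : F[X]} (hf : f.degree < n) :
    f = ∑ i, leftMinPoly (Set.range α \ {α i}) *
      C ((leftEval (leftMinPoly (Set.range α \ {α i})) (α i))⁻¹ * leftEval f (α i)) := by
  refine sub_eq_zero.1 (eq_zero_of_leftEval_eq_zero (Set.finite_range α) ?_ ?_)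
  · rw [degree_leftMinPoly_range hα hΛ]
    refine (degree_sub_le _ _).trans_lt (max_lt hf ?_)
    refine (degree_sum_le _ _).trans_lt ((Finset.sup_lt_iff (WithBot.bot_lt_coe n)).2 ?_)
    intro i _
    exact (degree_mul_C_le _ _).trans_lt (degree_leftMinPoly_diff_lt α i)
  · rintro _ ⟨m, rfl⟩
    rw [leftEval_sub, leftEval_sum, Finset.sum_eq_single m, leftEval_mul_C,
      mul_inv_cancel_left₀ (leftEval_leftMinPoly_diff_ne_zero hα hΛ m), sub_self]
    · intro i _ hi
      rw [leftEval_mul_C, leftEval_leftMinPoly_diff_of_ne hα hi.symm, zero_mul]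
    · simp

/-- Right Lagrange interpolation. -/
theorem eq_sum_C_mul_rightMinPoly {β : Fin n → F} (hβ : Function.Injective β)
    (hΩ : RightPIndependent (Set.range β)) {f : F[X]} (hf : f.degree < n) :
    f = ∑ j, C (f.eval (β j) * ((rightMinPoly (Set.range β \ {β j})).eval (β j))⁻¹) *
      rightMinPoly (Set.range β \ {β j}) := by
  refine sub_eq_zero.1 (eq_zero_of_eval_eq_zero (Set.finite_range β) ?_ ?_)
  · rw [degree_rightMinPoly_range hβ hΩ]
    refine (degree_sub_le _ _).trans_lt (max_lt hf ?_)
    refine (degree_sum_le _ _).trans_lt ((Finset.sup_lt_iff (WithBot.bot_lt_coe n)).2 ?_)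
    intro j _
    exact (degree_C_mul_le _ _).trans_lt (degree_rightMinPoly_diff_lt β j)
  · rintro _ ⟨m, rfl⟩
    rw [eval_sub, eval_finsetSum, Finset.sum_eq_single m, eval_C_mul,
      inv_mul_cancel_right₀ (eval_rightMinPoly_diff_ne_zero hβ hΩ m), sub_self]
    · intro j _ hj
      rw [eval_C_mul, eval_rightMinPoly_diff_of_ne hβ hj.symm, mul_zero]
    · simp

/-- The product vanishes at every `α m`, hence is a right multiple of the full minimal polynomial.
Its degree is at most `n`, so the monic cofactor is `1`. -/
theorem leftMinPoly_diff_mul_X_sub_C {α : Fin n → F} (hα : Function.Injective α)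
    (hΛ : LeftPIndependent (Set.range α)) (i : Fin n) :
    leftMinPoly (Set.range α \ {α i}) *
        (X - C ((leftEval (leftMinPoly (Set.range α \ {α i})) (α i))⁻¹ * α i *
          leftEval (leftMinPoly (Set.range α \ {α i})) (α i))) = leftMinPoly (Set.range α) := by
  have hp := leftMinPoly_monic (Set.finite_range α).sdiff (Δ := Set.range α \ {α i})
  have hd := degree_leftMinPoly_diff_lt α i
  rw [← natDegree_lt_iff_degree_lt hp.ne_zero] at hd
  set p := leftMinPoly (Set.range α \ {α i}) with hpdef
  have he : leftEval p (α i) ≠ 0 := leftEval_leftMinPoly_diff_ne_zero hα hΛ i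
  have hP := leftMinPoly_monic (Set.finite_range α)
  have hdP : (leftMinPoly (Set.range α)).natDegree = n :=
    natDegree_eq_of_degree_eq_some (degree_leftMinPoly_range hα hΛ)
  obtain ⟨u, hu⟩ := (exists_leftMinPoly_mul_eq_iff (Set.finite_range α)
    (f := p * (X - C ((leftEval p (α i))⁻¹ * α i * leftEval p (α i))))).2 (by
      rintro _ ⟨m, rfl⟩
      rcases eq_or_ne m i with rfl | hm
      · exact leftEval_mul_X_sub_C_conj he
      · exact leftEval_mul_eq_zero (leftEval_leftMinPoly_diff_of_ne hα hm) _)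
  have hm : u.Monic := Monic.of_mul_monic_left hP (hu ▸ hp.mul (monic_X_sub_C _))
  have hdeg := congrArg natDegree hu
  rw [hP.natDegree_mul hm, hp.natDegree_mul (monic_X_sub_C _), natDegree_X_sub_C, hdP] at hdeg
  rw [← hu, hm.natDegree_eq_zero.1 (by omega), mul_one]

/-- The exact degree, not just a bound, is what lets leading coefficients be compared below. -/
theorem natDegree_leftMinPoly_diff_add_one {α : Fin n → F} (hα : Function.Injective α)
    (hΛ : LeftPIndependent (Set.range α)) (i : Fin n) :
    (leftMinPoly (Set.range α \ {α i})).natDegree + 1 = n := by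
  have h := congrArg natDegree (leftMinPoly_diff_mul_X_sub_C hα hΛ i)
  rwa [(leftMinPoly_monic (Set.finite_range α).sdiff).natDegree_mul (monic_X_sub_C _),
    natDegree_X_sub_C, natDegree_eq_of_degree_eq_some (degree_leftMinPoly_range hα hΛ)] at h

/-- Intertwiners of `α i` and `b` give right zeros of `leftMinPoly (range α) * C d` at `b`. -/
theorem eval_leftMinPoly_mul_C_intertwiner {α : Fin n → F} (hα : Function.Injective α)
    (hΛ : LeftPIndependent (Set.range α)) (i : Fin n) {b φ : F} (hφ : α i * φ = φ * b) :
    (leftMinPoly (Set.range α) *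
      C ((leftEval (leftMinPoly (Set.range α \ {α i})) (α i))⁻¹ * φ)).eval b = 0 := by
  have he := leftEval_leftMinPoly_diff_ne_zero hα hΛ i
  rw [← leftMinPoly_diff_mul_X_sub_C hα hΛ i, mul_assoc]
  refine eval_mul_eq_zero ?_ _
  rw [sub_mul, X_mul_C, ← C_mul, eval_sub, eval_C_mul, eval_X, eval_C]
  simp only [mul_assoc]
  rw [mul_inv_cancel_left₀ he, hφ, sub_self]

/-- Every `d` for which `leftMinPoly (range α) * C d` has the right zero `b` comes from
intertwiners of the `α i` and `b`. -/
theorem exists_intertwiners_of_eval_leftMinPoly_mul_C {α : Fin n → F}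
    (hα : Function.Injective α) (hΛ : LeftPIndependent (Set.range α)) {b d : F}
    (hd : (leftMinPoly (Set.range α) * C d).eval b = 0) :
    ∃ φ : Fin n → F, (∀ i, α i * φ i = φ i * b) ∧
      d = ∑ i, (leftEval (leftMinPoly (Set.range α \ {α i})) (α i))⁻¹ * φ i := by
  obtain ⟨h, hh⟩ := Ideal.mem_span_singleton'.1 (mem_span_X_sub_C.2 hd)
  have hP := leftMinPoly_monic (Set.finite_range α)
  have hdP : (leftMinPoly (Set.range α)).natDegree = n :=
    natDegree_eq_of_degree_eq_some (degree_leftMinPoly_range hα hΛ)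
  -- The intertwining relation is the vanishing of `h * (X - C b)` under left evaluation at `α i`.
  refine ⟨fun i => leftEval h (α i), fun i => ?_, ?_⟩
  · have := leftEval_mul_eq_zero
      (leftEval_leftMinPoly (Set.finite_range α) (Set.mem_range_self i)) (C d)
    rw [← hh, mul_sub, leftEval_sub, leftEval_mul_X, leftEval_mul_C] at this
    exact sub_eq_zero.1 this
  · rcases eq_or_ne h 0 with rfl | h0
    · rw [zero_mul, eq_comm, hP.mul_right_eq_zero_iff, C_eq_zero] at hh
      simp [leftEval_zero, hh]
    have hd0 : d ≠ 0 := by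
      rintro rfl
      rw [C_0, mul_zero, (monic_X_sub_C b).mul_left_eq_zero_iff] at hh
      exact h0 hh
    have hdeg := congrArg natDegree hh
    rw [natDegree_mul h0 (X_sub_C_ne_zero b), natDegree_X_sub_C,
      natDegree_mul hP.ne_zero (C_ne_zero.2 hd0), natDegree_C, add_zero, hdP] at hdeg
    have hlt : h.degree < n := (natDegree_lt_iff_degree_lt h0).1 (by omega)
    have hlead : h.coeff h.natDegree = d := by
      have := congrArg leadingCoeff hh
      rwa [leadingCoeff_mul_monic (monic_X_sub_C b), leadingCoeff_mul, hP.leadingCoeff, leadingCoeff_C, one_mul] at this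
    -- `h` has degree `n - 1`, as does each monic Lagrange basis polynomial, so this coefficient
    -- reads off the weights.
    have hsum := congrArg (fun f => f.coeff h.natDegree) (eq_sum_leftMinPoly_mul_C hα hΛ hlt)
    rw [hlead, finsetSum_coeff] at hsum
    rw [hsum]
    refine Finset.sum_congr rfl fun i _ => ?_
    rw [coeff_mul_C]
    have hp := leftMinPoly_monic (Set.finite_range α).sdiff (Δ := Set.range α \ {α i})
    have hpd := natDegree_leftMinPoly_diff_add_one hα hΛ i
    rw [show h.natDegree = (leftMinPoly (Set.range α \ {α i})).natDegree by omega,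
      hp.coeff_natDegree, one_mul]

theorem isConj_of_intertwiner {a b φ : F} (h : a * φ = φ * b) (h0 : φ ≠ 0) : IsConj a b :=
  IsConj.symm ⟨Units.mk0 φ h0, h.symm⟩

end Lagrange

end TwoSidedLagrange

/-! ### The two-sided homogeneous problem. -/

open TwoSidedLagrange in
theorem corollary3p7 {F : Type*} [DivisionRing F] [DecidableRel (IsConj : F → F → Prop)]
    {n k : ℕ} (α : Fin n → F) (β : Fin k → F)
    (hα : Function.Injective α) (hβ : Function.Injective β)
    (hαalg : ∀ i, IsAlgebraic (Subring.center F) (α i))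
    (hΛ : LeftPIndependent (Set.range α)) (hΩ : RightPIndependent (Set.range β)) :
    (∀ i, leftEval (leftMinPoly (Set.range α \ {α i})) (α i) ≠ 0) ∧
    (∀ j, (rightMinPoly (Set.range β \ {β j})).eval (β j) ≠ 0) ∧
    ∀ g : F[X],
      (g.degree < ((n + k : ℕ) : WithBot ℕ) ∧
          (∀ i, leftEval g (α i) = 0) ∧ (∀ j, g.eval (β j) = 0)) ↔
        ∃ φ : Fin n → Fin k → F,
          (∀ i j, IsConj (α i) (β j) → α i * φ i j = φ i j * β j) ∧
          g = leftMinPoly (Set.range α) *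
            ∑ x : Fin n × Fin k with IsConj (α x.1) (β x.2),
              C ((leftEval (leftMinPoly (Set.range α \ {α x.1})) (α x.1))⁻¹ * φ x.1 x.2 *
                  ((rightMinPoly (Set.range β \ {β x.2})).eval (β x.2))⁻¹) *
                rightMinPoly (Set.range β \ {β x.2}) := by
  have hpe := leftEval_leftMinPoly_diff_ne_zero hα hΛ
  have hqe := eval_rightMinPoly_diff_ne_zero hβ hΩ
  refine ⟨hpe, hqe, fun g => ⟨?_, ?_⟩⟩
  · rintro ⟨hdeg, hl, hr⟩
    obtain ⟨h, rfl⟩ := (exists_leftMinPoly_mul_eq_iff (Set.finite_range α) (f := g)).2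
      (by rintro _ ⟨i, rfl⟩; exact hl i)
    have hk : h.degree < k := by
      rw [degree_mul, degree_leftMinPoly_range hα hΛ, Nat.cast_add] at hdeg
      exact lt_of_add_lt_add_left hdeg
    have key : ∀ j, ∃ φ : Fin n → F, (∀ i, α i * φ i = φ i * β j) ∧
        h.eval (β j) =
          ∑ i, (leftEval (leftMinPoly (Set.range α \ {α i})) (α i))⁻¹ * φ i := by
      intro j
      refine exists_intertwiners_of_eval_leftMinPoly_mul_C hα hΛ ?_
      -- Only the remainder of `h` modulo `X - C (β j)` affects the right value of the product at `β
      -- j`.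
      obtain ⟨u, hu⟩ := exists_eq_C_eval_add h (β j)
      have := hr j
      rw [hu, mul_add, eval_add, ← mul_assoc, eval_mul_X_sub_C, add_zero] at this
      exact this
    choose φ hφ hs using key
    refine ⟨fun i j => φ j i, fun i j _ => hφ j i, ?_⟩
    congr 1
    conv_lhs => rw [eq_sum_C_mul_rightMinPoly hβ hΩ hk]
    rw [Finset.sum_filter, Fintype.sum_prod_type_right]
    refine Finset.sum_congr rfl fun j _ => ?_
    rw [hs j, Finset.sum_mul, map_sum, Finset.sum_mul]
    refine Finset.sum_congr rfl fun i _ => ?_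
    split_ifs with hc
    · rfl
    · have h0 : φ j i = 0 := by
        by_contra h0
        exact hc (isConj_of_intertwiner (hφ j i) h0)
      rw [h0, mul_zero, zero_mul, C_0, zero_mul]
  · rintro ⟨φ, hφ, rfl⟩
    refine ⟨?_, fun i => leftEval_mul_eq_zero
      (leftEval_leftMinPoly (Set.finite_range α) (Set.mem_range_self i)) _, fun j => ?_⟩
    · rw [degree_mul, degree_leftMinPoly_range hα hΛ, Nat.cast_add]
      -- Strictness survives because `n` is not `⊥`; the sum itself may be zero.
      refine WithBot.add_lt_add_left (WithBot.natCast_ne_bot n) ?_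
      refine (degree_sum_le _ _).trans_lt ((Finset.sup_lt_iff (WithBot.bot_lt_coe k)).2 ?_)
      intro x _
      exact (degree_C_mul_le _ _).trans_lt (degree_rightMinPoly_diff_lt β x.2)
    · rw [Finset.mul_sum, eval_finsetSum]
      refine Finset.sum_eq_zero fun x hx => ?_
      have hx' := (Finset.mem_filter.1 hx).2
      obtain ⟨u, hu⟩ := exists_eq_C_eval_add (rightMinPoly (Set.range β \ {β x.2})) (β j)
      -- At its own node, the value of the basis polynomial cancels the inverse weight, leaving the
      -- intertwiner lemma; at other nodes it vanishes.
      rcases eq_or_ne j x.2 with rfl | hj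
      · rw [hu, eval_add, eval_C, eval_mul_X_sub_C, add_zero, mul_add, mul_add, eval_add,
          ← C_mul, ← mul_assoc, ← mul_assoc, eval_mul_X_sub_C, add_zero,
          inv_mul_cancel_right₀ (hqe _)]
        exact eval_leftMinPoly_mul_C_intertwiner hα hΛ x.1 (hφ x.1 x.2 hx')
      · exact eval_mul_eq_zero (eval_mul_eq_zero (eval_rightMinPoly_diff_of_ne hβ hj) _) _
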